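/- Let $I\subset\mathbb R$ be a nonempty open interval and let $s\mapsto(x(s),0,z(s))$, $s\in I$, be a smooth unit speed curve with $x(s)>0$. Let $M$ be the surface of revolution in Euclidean space $\mathbb E^3$ parametrized by $$X(s,t)=(x(s)\cos t,\;x(s)\sin t,\;z(s)),\qquad (s,t)\in I\times\mathbb R,$$ with Gauss map $G=\dfrac{X_s\times X_t}{\|X_s\times X_t\|}$ and shape operator $S=-dG$. For a smooth function $f$ on $M$ let $\nabla^2 f$ be the self-adjoint operator on the tangent planes metrically equivalent to the Hessian of $f$ with respect to the induced metric, and put $$\Delta f=-\operatorname{tr}(\nabla^2 f),\qquad \square f=-\operatorname{tr}\big((\operatorname{tr}(S)\,\mathrm{Id}-S)\circ\nabla^2 f\big)$$ (the Laplace operator and the Cheng–Yau operator); both act on the $\mathbb R^3$-valued map $G$ coordinatewise. Then the following are equivalent. 1) $M$ is an open part of a right circular cone; that is, there are a point $a\in\mathbb E^3$, a unit vector $v$ and an angle $\varphi\in(0,\pi/2)$ such that $X(I\times\mathbb R)$ is a relatively open subset of $\{p\in\mathbb E^3: p\neq a,\ \langle v,p-a\rangle=\cos\varphi\,\|p-a\|\}$.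 2) There is a matrix $A\in\mathbb R^{3\times3}$ with $\square G=AG$ on $M$, but there is no matrix $A\in\mathbb R^{3\times3}$ with $\Delta G=AG$ on $M$. -/

import Mathlib

open scoped ContDiff Matrix

noncomputable section

/-- Euclidean 3-space. -/
abbrev E3 : Type := EuclideanSpace ℝ (Fin 3)

/-! ## Local differential geometry of a parametrized surface

A parametrized surface is a map `X` from (an open part of) the parameter plane `Fin 2 → ℝ` to `E3`.
A function on the surface is written as a function of the two parameters. -/

/-- The partial derivative `∂ᵢ f` with respect to the `i`-th parameter. -/
def pd {F : Type*} [NormedAddCommGroup F] [NormedSpace ℝ F]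
    (i : Fin 2) (f : (Fin 2 → ℝ) → F) (u : Fin 2 → ℝ) : F :=
  deriv (fun r : ℝ => f (Function.update u i r)) (u i)

/-- The cross product of `E3`. -/
def cross (v w : E3) : E3 := WithLp.toLp 2 (crossProduct (WithLp.ofLp v) (WithLp.ofLp w))

/-- The Gauss map `G = (∂₀X × ∂₁X) / ‖∂₀X × ∂₁X‖`. -/
def gaussMap (X : (Fin 2 → ℝ) → E3) (u : Fin 2 → ℝ) : E3 :=
  ‖cross (pd 0 X u) (pd 1 X u)‖⁻¹ • cross (pd 0 X u) (pd 1 X u)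

/-- The first fundamental form (the metric induced from `E3`), `g i j = ⟨∂ᵢX, ∂ⱼX⟩`. -/
def firstForm (X : (Fin 2 → ℝ) → E3) (u : Fin 2 → ℝ) : Matrix (Fin 2) (Fin 2) ℝ :=
  Matrix.of fun i j => inner ℝ (pd i X u) (pd j X u)

/-- The second fundamental form with respect to the Gauss map, `h i j = ⟨∂ᵢ∂ⱼX, G⟩`. -/
def secondForm (X : (Fin 2 → ℝ) → E3) (u : Fin 2 → ℝ) : Matrix (Fin 2) (Fin 2) ℝ :=
  Matrix.of fun i j => inner ℝ (pd i (pd j X) u) (gaussMap X u)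

/-- The shape operator `S = -dG` with respect to the Gauss map, as a matrix in the coordinate frame
`∂₀X, ∂₁X` of the tangent plane: it is metrically equivalent to the second fundamental form. -/
def shapeOperator (X : (Fin 2 → ℝ) → E3) (u : Fin 2 → ℝ) : Matrix (Fin 2) (Fin 2) ℝ :=
  (firstForm X u)⁻¹ * secondForm X u

/-- The Christoffel symbols `Γᵏᵢⱼ = ½ ∑ₗ gᵏˡ (∂ᵢ gⱼₗ + ∂ⱼ gᵢₗ - ∂ₗ gᵢⱼ)` of the induced metric. -/
def christoffel (X : (Fin 2 → ℝ) → E3) (k i j : Fin 2) (u : Fin 2 → ℝ) : ℝ :=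
  (1 / 2) * ∑ l : Fin 2, (firstForm X u)⁻¹ k l *
    (pd i (fun w => firstForm X w j l) u + pd j (fun w => firstForm X w i l) u
      - pd l (fun w => firstForm X w i j) u)

/-- The Hessian form of a function for the induced metric, `∂ᵢ∂ⱼf - ∑ₖ Γᵏᵢⱼ ∂ₖf`. -/
def hessianForm (X : (Fin 2 → ℝ) → E3) (f : (Fin 2 → ℝ) → ℝ) (u : Fin 2 → ℝ) :
    Matrix (Fin 2) (Fin 2) ℝ :=
  Matrix.of fun i j => pd i (pd j f) u - ∑ k : Fin 2, christoffel X k i j u * pd k f u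

/-- The self-adjoint operator `∇²f` of the tangent plane which is metrically equivalent to the
Hessian form, as a matrix in the coordinate frame. -/
def hessianOperator (X : (Fin 2 → ℝ) → E3) (f : (Fin 2 → ℝ) → ℝ) (u : Fin 2 → ℝ) :
    Matrix (Fin 2) (Fin 2) ℝ :=
  (firstForm X u)⁻¹ * hessianForm X f u

/-- The Laplace operator `Δ f = -tr (∇²f)`. -/
def laplaceOp (X : (Fin 2 → ℝ) → E3) (f : (Fin 2 → ℝ) → ℝ) (u : Fin 2 → ℝ) : ℝ :=
  -Matrix.trace (hessianOperator X f u)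

/-- The Cheng-Yau operator `□ f = -tr ((tr(S) I - S) ∘ ∇²f)`. -/
def chengYauOp (X : (Fin 2 → ℝ) → E3) (f : (Fin 2 → ℝ) → ℝ) (u : Fin 2 → ℝ) : ℝ :=
  -Matrix.trace (((Matrix.trace (shapeOperator X u)) • (1 : Matrix (Fin 2) (Fin 2) ℝ)
      - shapeOperator X u) * hessianOperator X f u)

/-- An operator on functions satisfies `T G = A G` on the part of the parameter plane `D`, where `G`
is the Gauss map of `X`, on whose three coordinate functions `T` acts. -/
def GaussMapSatisfies (T : ((Fin 2 → ℝ) → ℝ) → (Fin 2 → ℝ) → ℝ) (X : (Fin 2 → ℝ) → E3)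
    (D : Set (Fin 2 → ℝ)) (A : Matrix (Fin 3) (Fin 3) ℝ) : Prop :=
  ∀ u ∈ D, ∀ i : Fin 3,
    T (fun w => gaussMap X w i) u = (A *ᵥ WithLp.ofLp (gaussMap X u)) i

/-! ## Surfaces of revolution and cones -/

/-- `s ↦ (x s, 0, z s)` is a smooth unit speed curve with `x > 0`, on the nonempty open
interval `I`. -/
structure IsProfileCurve (x z : ℝ → ℝ) (I : Set ℝ) : Prop where
  isOpen : IsOpen I
  ordConnected : I.OrdConnected
  nonempty : I.Nonempty
  smooth_x : ContDiffOn ℝ ∞ x I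
  smooth_z : ContDiffOn ℝ ∞ z I
  pos : ∀ s ∈ I, 0 < x s
  unit_speed : ∀ s ∈ I, deriv x s ^ 2 + deriv z s ^ 2 = 1

/-- Rotation of the curve `(x, 0, z)` around the third coordinate axis; the parameters are
`s = u 0` and `t = u 1`. -/
def revolution (x z : ℝ → ℝ) (u : Fin 2 → ℝ) : E3 :=
  !₂[x (u 0) * Real.cos (u 1), x (u 0) * Real.sin (u 1), z (u 0)]

/-- The parameter domain `I × ℝ`. -/
def revolutionDomain (I : Set ℝ) : Set (Fin 2 → ℝ) := {u | u 0 ∈ I}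

/-- A right circular cone: the half-lines from an apex `a` (without `a`, where the cone is not
smooth) that make a fixed angle `φ`, strictly between `0` and `π / 2`, with a unit vector `v`. -/
def IsRightCircularCone (C : Set E3) : Prop :=
  ∃ (a v : E3) (φ : ℝ), ‖v‖ = 1 ∧ 0 < φ ∧ φ < Real.pi / 2 ∧
    C = {p | p ≠ a ∧ inner ℝ v (p - a) = Real.cos φ * ‖p - a‖}

/-- `M` is an open part of `C`: a subset that is open in the subspace topology of `C`. -/
def IsOpenPart (M C : Set E3) : Prop := ∃ U : Set E3, IsOpen U ∧ M = U ∩ C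

end

open Topology

/-! ### Partial derivatives in the parameter plane. -/

section PartialDerivatives

variable {F : Type*} [NormedAddCommGroup F] [NormedSpace ℝ F]

/-! Write k for the curvature of the profile, r = x, c = x', w = z'. The principal curvatures are k
and w / r. By rotational symmetry `□ G = A G` implies two ODEs containing only the entries l = A₀₀
and m = A₂₂ of the matrix. Combined, they give k w (k r + w) = r² (m - (m - l) w²) and K' = (m - l)
c w, where K = k w / r is the Gauss curvature. If l ≠ m, repeated differentiation of the first
relation, with k' eliminated by the second, produces three algebraic relations that cannot hold
together where c w ≠ 0 (`no_common_zero`); hence c w = 0 and then k = 0. If l = m, K is constant and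
either k = 0 or k r = w, the umbilic case (`curvature_eq_zero_or_isotropic`). Umbilic surfaces,
planes and cylinders all satisfy `Δ G = A G`, so excluding that equation leaves a line oblique to
the axis, which sweeps out part of a cone (`isOpenPart_cone_of_line`). Conversely, a cone containing
a circle of the surface is coaxial with it (`coaxial_of_circle_subset`), so the profile is an
oblique line. Then k = 0 gives `□ G = 0`, whereas `Δ G = A G` would force A₀₀ r² = 1 although r is
not constant. -/

lemma continuous_update_self (u : Fin 2 → ℝ) (i : Fin 2) :
    Continuous fun r : ℝ => Function.update u i r :=
  continuous_const.update i continuous_id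

lemma pd_congr {D : Set (Fin 2 → ℝ)} (hD : IsOpen D) {f g : (Fin 2 → ℝ) → F}
    (h : Set.EqOn f g D) (i : Fin 2) : Set.EqOn (pd i f) (pd i g) D := by
  intro u hu
  apply Filter.EventuallyEq.deriv_eq
  have ht : Filter.Tendsto (fun r : ℝ => Function.update u i r) (𝓝 (u i)) (𝓝 u) := by
    simpa using (continuous_update_self u i).tendsto (u i)
  filter_upwards [ht.eventually (hD.mem_nhds hu)] with r hr using h hr

/-- No differentiability is needed, since a constant factor always passes through `deriv`. The
coordinates of the Gauss map are such products, so both operators act on them by separation of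
variables. -/
lemma pd_zero_mul (p q : ℝ → ℝ) :
    pd 0 (fun u => p (u 0) * q (u 1)) = fun u => deriv p (u 0) * q (u 1) := by
  funext u
  simp [pd]

lemma pd_one_mul (p q : ℝ → ℝ) :
    pd 1 (fun u => p (u 0) * q (u 1)) = fun u => p (u 0) * deriv q (u 1) := by
  funext u
  simp [pd]

end PartialDerivatives

lemma hasDerivAt_vec3 {a b c : ℝ → ℝ} {a' b' c' s : ℝ} (ha : HasDerivAt a a' s)
    (hb : HasDerivAt b b' s) (hc : HasDerivAt c c' s) :
    HasDerivAt (fun r => (!₂[a r, b r, c r] : E3)) !₂[a', b', c'] s := by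
  have h : HasDerivAt (fun r => (![a r, b r, c r] : Fin 3 → ℝ)) ![a', b', c'] s := by
    rw [hasDerivAt_pi]
    intro i
    fin_cases i <;> simpa
  exact (PiLp.hasFDerivAt_toLp (𝕜 := ℝ) 2 (![a s, b s, c s] : Fin 3 → ℝ)).comp_hasDerivAt s h

/-- The curvature of the plane curve `(x, z)`, if it has unit speed. -/
noncomputable def profileCurvature (x z : ℝ → ℝ) (s : ℝ) : ℝ :=
  deriv x s * deriv (deriv z) s - deriv z s * deriv (deriv x) s

lemma isOpen_revolutionDomain {I : Set ℝ} (hI : IsOpen I) : IsOpen (revolutionDomain I) :=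
  hI.preimage (continuous_apply 0)

lemma ContDiffOn.smooth_deriv {f : ℝ → ℝ} {I : Set ℝ} (hf : ContDiffOn ℝ ∞ f I)
    (hI : IsOpen I) : ContDiffOn ℝ ∞ (deriv f) I :=
  hf.deriv_of_isOpen hI (by simp)

lemma ContDiffOn.hasDerivAt_of_smooth {f : ℝ → ℝ} {I : Set ℝ} (hf : ContDiffOn ℝ ∞ f I)
    (hI : IsOpen I) {s : ℝ} (hs : s ∈ I) : HasDerivAt f (deriv f s) s :=
  ((hf.differentiableOn (by simp)).differentiableAt (hI.mem_nhds hs)).hasDerivAt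

/-- The device by which every identity along the profile is differentiated. -/
lemma HasDerivAt.eq_of_eqOn {I : Set ℝ} (hI : IsOpen I) {f g : ℝ → ℝ} {f' g' s : ℝ}
    (hs : s ∈ I) (hf : HasDerivAt f f' s) (hg : HasDerivAt g g' s) (h : Set.EqOn f g I) :
    f' = g' :=
  hf.unique (hg.congr_of_eventuallyEq (h.eventuallyEq_of_mem (hI.mem_nhds hs)))

/-! ### Frenet equations of the profile and local geometry of the surface. -/

namespace IsProfileCurve

variable {x z : ℝ → ℝ} {I : Set ℝ} (hC : IsProfileCurve x z I) {s : ℝ} {u : Fin 2 → ℝ}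

include hC

lemma hasDerivAt_x (hs : s ∈ I) : HasDerivAt x (deriv x s) s :=
  hC.smooth_x.hasDerivAt_of_smooth hC.isOpen hs

lemma hasDerivAt_z (hs : s ∈ I) : HasDerivAt z (deriv z s) s :=
  hC.smooth_z.hasDerivAt_of_smooth hC.isOpen hs

lemma hasDerivAt_deriv_x' (hs : s ∈ I) : HasDerivAt (deriv x) (deriv (deriv x) s) s :=
  (hC.smooth_x.smooth_deriv hC.isOpen).hasDerivAt_of_smooth hC.isOpen hs

lemma hasDerivAt_deriv_z' (hs : s ∈ I) : HasDerivAt (deriv z) (deriv (deriv z) s) s :=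
  (hC.smooth_z.smooth_deriv hC.isOpen).hasDerivAt_of_smooth hC.isOpen hs

lemma smooth_profileCurvature : ContDiffOn ℝ ∞ (profileCurvature x z) I :=
  ((hC.smooth_x.smooth_deriv hC.isOpen).mul
    ((hC.smooth_z.smooth_deriv hC.isOpen).smooth_deriv hC.isOpen)).sub
  ((hC.smooth_z.smooth_deriv hC.isOpen).mul
    ((hC.smooth_x.smooth_deriv hC.isOpen).smooth_deriv hC.isOpen))

lemma hasDerivAt_profileCurvature (hs : s ∈ I) :
    HasDerivAt (profileCurvature x z) (deriv (profileCurvature x z) s) s :=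
  hC.smooth_profileCurvature.hasDerivAt_of_smooth hC.isOpen hs

lemma deriv_mul_deriv_deriv (hs : s ∈ I) :
    deriv x s * deriv (deriv x) s + deriv z s * deriv (deriv z) s = 0 := by
  have h := HasDerivAt.eq_of_eqOn hC.isOpen hs
    (((hC.hasDerivAt_deriv_x' hs).pow 2).add ((hC.hasDerivAt_deriv_z' hs).pow 2))
    (hasDerivAt_const s (1 : ℝ)) hC.unit_speed
  norm_num at h
  linarith

/-- Frenet equation: the acceleration is orthogonal to the unit tangent (c, w), hence equals k (-w,
c). -/
lemma deriv_deriv_x (hs : s ∈ I) :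
    deriv (deriv x) s = -(profileCurvature x z s * deriv z s) := by
  have h1 := hC.deriv_mul_deriv_deriv hs
  have h2 := hC.unit_speed s hs
  unfold profileCurvature
  linear_combination (-deriv (deriv x) s) * h2 + deriv x s * h1

lemma deriv_deriv_z (hs : s ∈ I) :
    deriv (deriv z) s = profileCurvature x z s * deriv x s := by
  have h1 := hC.deriv_mul_deriv_deriv hs
  have h2 := hC.unit_speed s hs
  unfold profileCurvature
  linear_combination (-deriv (deriv z) s) * h2 + deriv z s * h1

lemma hasDerivAt_deriv_x (hs : s ∈ I) :
    HasDerivAt (deriv x) (-(profileCurvature x z s * deriv z s)) s :=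
  hC.deriv_deriv_x hs ▸ hC.hasDerivAt_deriv_x' hs

lemma hasDerivAt_deriv_z (hs : s ∈ I) :
    HasDerivAt (deriv z) (profileCurvature x z s * deriv x s) s :=
  hC.deriv_deriv_z hs ▸ hC.hasDerivAt_deriv_z' hs

lemma deriv_deriv_deriv_x (hs : s ∈ I) :
    deriv (deriv (deriv x)) s = -(deriv (profileCurvature x z) s * deriv z s
      + profileCurvature x z s ^ 2 * deriv x s) := by
  have h := HasDerivAt.eq_of_eqOn hC.isOpen hs
    (((hC.smooth_x.smooth_deriv hC.isOpen).smooth_deriv hC.isOpen).hasDerivAt_of_smooth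
      hC.isOpen hs)
    ((hC.hasDerivAt_profileCurvature hs).mul (hC.hasDerivAt_deriv_z hs)).neg
    fun r hr => hC.deriv_deriv_x hr
  rw [h]
  ring

lemma deriv_deriv_deriv_z (hs : s ∈ I) :
    deriv (deriv (deriv z)) s = deriv (profileCurvature x z) s * deriv x s
      - profileCurvature x z s ^ 2 * deriv z s := by
  have h := HasDerivAt.eq_of_eqOn hC.isOpen hs
    (((hC.smooth_z.smooth_deriv hC.isOpen).smooth_deriv hC.isOpen).hasDerivAt_of_smooth
      hC.isOpen hs)
    ((hC.hasDerivAt_profileCurvature hs).mul (hC.hasDerivAt_deriv_x hs))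
    fun r hr => hC.deriv_deriv_z hr
  rw [h]
  ring

lemma pd_zero_revolution (hu : u ∈ revolutionDomain I) :
    pd 0 (revolution x z) u =
      !₂[deriv x (u 0) * Real.cos (u 1), deriv x (u 0) * Real.sin (u 1), deriv z (u 0)] := by
  have hx := hC.hasDerivAt_x hu
  have hz := hC.hasDerivAt_z hu
  have h := hasDerivAt_vec3 (hx.mul_const (Real.cos (u 1))) (hx.mul_const (Real.sin (u 1))) hz
  simpa [pd, revolution] using h.deriv

omit hC in
lemma pd_one_revolution :
    pd 1 (revolution x z) =
      fun u => !₂[-(x (u 0) * Real.sin (u 1)), x (u 0) * Real.cos (u 1), 0] := by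
  funext u
  have h := hasDerivAt_vec3 ((Real.hasDerivAt_cos (u 1)).const_mul (x (u 0)))
    ((Real.hasDerivAt_sin (u 1)).const_mul (x (u 0))) (hasDerivAt_const (u 1) (z (u 0)))
  simpa [pd, revolution] using h.deriv

lemma pd_zero_pd_zero_revolution (hu : u ∈ revolutionDomain I) :
    pd 0 (pd 0 (revolution x z)) u =
      !₂[deriv (deriv x) (u 0) * Real.cos (u 1), deriv (deriv x) (u 0) * Real.sin (u 1),
        deriv (deriv z) (u 0)] := by
  have hx := hC.hasDerivAt_deriv_x' hu
  have hz := hC.hasDerivAt_deriv_z' hu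
  rw [pd_congr (isOpen_revolutionDomain hC.isOpen) (fun v hv => hC.pd_zero_revolution hv) 0 hu]
  have h := hasDerivAt_vec3 (hx.mul_const (Real.cos (u 1))) (hx.mul_const (Real.sin (u 1))) hz
  simpa [pd] using h.deriv

lemma pd_zero_pd_one_revolution (hu : u ∈ revolutionDomain I) :
    pd 0 (pd 1 (revolution x z)) u =
      !₂[-(deriv x (u 0) * Real.sin (u 1)), deriv x (u 0) * Real.cos (u 1), 0] := by
  have hx := hC.hasDerivAt_x hu
  rw [pd_one_revolution]
  have h := hasDerivAt_vec3 (hx.mul_const (Real.sin (u 1))).neg (hx.mul_const (Real.cos (u 1)))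
    (hasDerivAt_const (u 0) (0 : ℝ))
  simpa [pd] using h.deriv

lemma pd_one_pd_zero_revolution (hu : u ∈ revolutionDomain I) :
    pd 1 (pd 0 (revolution x z)) u =
      !₂[-(deriv x (u 0) * Real.sin (u 1)), deriv x (u 0) * Real.cos (u 1), 0] := by
  rw [pd_congr (isOpen_revolutionDomain hC.isOpen) (fun v hv => hC.pd_zero_revolution hv) 1 hu]
  have h := hasDerivAt_vec3 ((Real.hasDerivAt_cos (u 1)).const_mul (deriv x (u 0)))
    ((Real.hasDerivAt_sin (u 1)).const_mul (deriv x (u 0)))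
    (hasDerivAt_const (u 1) (deriv z (u 0)))
  simpa [pd] using h.deriv

omit hC in
lemma pd_one_pd_one_revolution :
    pd 1 (pd 1 (revolution x z)) u =
      !₂[-(x (u 0) * Real.cos (u 1)), -(x (u 0) * Real.sin (u 1)), 0] := by
  rw [pd_one_revolution]
  have h := hasDerivAt_vec3 ((Real.hasDerivAt_sin (u 1)).const_mul (x (u 0))).neg
    ((Real.hasDerivAt_cos (u 1)).const_mul (x (u 0))) (hasDerivAt_const (u 1) (0 : ℝ))
  simpa [pd] using h.deriv

lemma gaussMap_revolution (hu : u ∈ revolutionDomain I) :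
    gaussMap (revolution x z) u =
      !₂[-(deriv z (u 0) * Real.cos (u 1)), -(deriv z (u 0) * Real.sin (u 1)),
        deriv x (u 0)] := by
  have hx := hC.pos _ hu
  have h1 := hC.unit_speed _ hu
  have h2 := Real.sin_sq_add_cos_sq (u 1)
  have hcr : cross (pd 0 (revolution x z) u) (pd 1 (revolution x z) u) =
      x (u 0) • !₂[-(deriv z (u 0) * Real.cos (u 1)), -(deriv z (u 0) * Real.sin (u 1)),
        deriv x (u 0)] := by
    rw [hC.pd_zero_revolution hu, pd_one_revolution]
    ext i
    fin_cases i
    · simp [cross, crossProduct]; ring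
    · simp [cross, crossProduct]; ring
    · simp [cross, crossProduct]
      linear_combination (deriv x (u 0) * x (u 0)) * h2
  have hn : ‖(!₂[-(deriv z (u 0) * Real.cos (u 1)), -(deriv z (u 0) * Real.sin (u 1)),
        deriv x (u 0)] : E3)‖ = 1 := by
    rw [EuclideanSpace.norm_eq, Real.sqrt_eq_one]
    simp [Fin.sum_univ_three]
    linear_combination h1 + deriv z (u 0) ^ 2 * h2
  rw [gaussMap, hcr, norm_smul, hn, Real.norm_of_nonneg hx.le, smul_smul]
  field_simp
  simp

lemma firstForm_revolution (hu : u ∈ revolutionDomain I) :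
    firstForm (revolution x z) u = Matrix.diagonal ![1, x (u 0) ^ 2] := by
  have h1 := hC.unit_speed _ hu
  have h2 := Real.sin_sq_add_cos_sq (u 1)
  ext i j
  fin_cases i <;> fin_cases j <;>
    simp [firstForm, hC.pd_zero_revolution hu, pd_one_revolution, PiLp.inner_apply,
      Fin.sum_univ_three]
  · linear_combination h1 + deriv x (u 0) ^ 2 * h2
  · ring
  · ring
  · linear_combination x (u 0) ^ 2 * h2

lemma inv_firstForm_revolution (hu : u ∈ revolutionDomain I) :
    (firstForm (revolution x z) u)⁻¹ = Matrix.diagonal ![1, (x (u 0) ^ 2)⁻¹] := by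
  have hx := hC.pos _ hu
  rw [hC.firstForm_revolution hu]
  apply Matrix.inv_eq_right_inv
  rw [Matrix.diagonal_mul_diagonal, ← Matrix.diagonal_one]
  congr 1
  ext i
  fin_cases i <;> simp [hx.ne']

lemma shapeOperator_revolution (hu : u ∈ revolutionDomain I) :
    shapeOperator (revolution x z) u =
      Matrix.diagonal ![profileCurvature x z (u 0), deriv z (u 0) / x (u 0)] := by
  have hx := hC.pos _ hu
  have h2 := Real.sin_sq_add_cos_sq (u 1)
  rw [shapeOperator, hC.inv_firstForm_revolution hu]
  ext i j
  fin_cases i <;> fin_cases j <;>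
    simp [secondForm, hC.pd_zero_pd_zero_revolution hu, hC.pd_zero_pd_one_revolution hu,
      hC.pd_one_pd_zero_revolution hu, pd_one_pd_one_revolution, hC.gaussMap_revolution hu,
      PiLp.inner_apply, Fin.sum_univ_three, profileCurvature]
  · linear_combination (-deriv z (u 0) * deriv (deriv x) (u 0)) * h2
  · ring
  · right; ring
  · field_simp
    linear_combination deriv z (u 0) * h2

lemma pd_firstForm_revolution (hu : u ∈ revolutionDomain I) (k i j : Fin 2) :
    pd k (fun w => firstForm (revolution x z) w i j) u =
      if k = 0 ∧ i = 1 ∧ j = 1 then 2 * x (u 0) * deriv x (u 0) else 0 := by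
  have hD := isOpen_revolutionDomain hC.isOpen
  rw [pd_congr (g := fun w => (Matrix.diagonal ![1, x (w 0) ^ 2] : Matrix _ _ ℝ) i j) hD
    (fun v hv => by simp only [hC.firstForm_revolution hv]) k hu]
  have h := (hC.hasDerivAt_x hu).pow 2
  have h' := h.deriv
  fin_cases k <;> fin_cases i <;> fin_cases j <;> simp [pd]
  simpa [Pi.pow_def] using h'

lemma christoffel_revolution (hu : u ∈ revolutionDomain I) (k i j : Fin 2) :
    christoffel (revolution x z) k i j u =
      if k = 0 then (if i = 1 ∧ j = 1 then -(x (u 0) * deriv x (u 0)) else 0)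
      else if i = j then 0 else deriv x (u 0) / x (u 0) := by
  have hx := hC.pos _ hu
  simp only [christoffel, hC.inv_firstForm_revolution hu, hC.pd_firstForm_revolution hu,
    Fin.sum_univ_two]
  fin_cases k <;> fin_cases i <;> fin_cases j <;> simp <;> field_simp

lemma laplaceOp_revolution (hu : u ∈ revolutionDomain I) (f : (Fin 2 → ℝ) → ℝ) :
    laplaceOp (revolution x z) f u = -(pd 0 (pd 0 f) u
      + (pd 1 (pd 1 f) u + x (u 0) * deriv x (u 0) * pd 0 f u) / x (u 0) ^ 2) := by
  have hx := hC.pos _ hu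
  simp [laplaceOp, hessianOperator, hessianForm, hC.inv_firstForm_revolution hu,
    hC.christoffel_revolution hu, Matrix.trace_fin_two, Matrix.mul_apply, Fin.sum_univ_two]
  field_simp

/-- Since S is diagonal, tr(S) Id - S merely exchanges the two principal curvatures as weights of
the two Hessian terms. -/
lemma chengYauOp_revolution (hu : u ∈ revolutionDomain I) (f : (Fin 2 → ℝ) → ℝ) :
    chengYauOp (revolution x z) f u = -(deriv z (u 0) / x (u 0) * pd 0 (pd 0 f) u
      + profileCurvature x z (u 0) *
        ((pd 1 (pd 1 f) u + x (u 0) * deriv x (u 0) * pd 0 f u) / x (u 0) ^ 2)) := by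
  have hx := hC.pos _ hu
  simp [chengYauOp, hessianOperator, hessianForm, hC.inv_firstForm_revolution hu,
    hC.christoffel_revolution hu, hC.shapeOperator_revolution hu, Matrix.trace_fin_two,
    Matrix.mul_apply, Fin.sum_univ_two, Matrix.sub_apply]
  field_simp
  simp

/-- The Laplace operator of a product of a function of `s` and a function of `t`. -/
lemma laplaceOp_revolution_mul (hu : u ∈ revolutionDomain I) {f : (Fin 2 → ℝ) → ℝ} {p q : ℝ → ℝ}
    (hf : Set.EqOn f (fun v => p (v 0) * q (v 1)) (revolutionDomain I)) :
    laplaceOp (revolution x z) f u = -(deriv (deriv p) (u 0) * q (u 1)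
      + (p (u 0) * deriv (deriv q) (u 1) + x (u 0) * deriv x (u 0) * (deriv p (u 0) * q (u 1)))
        / x (u 0) ^ 2) := by
  have hD := isOpen_revolutionDomain hC.isOpen
  rw [hC.laplaceOp_revolution hu, pd_congr hD (pd_congr hD hf 0) 0 hu,
    pd_congr hD (pd_congr hD hf 1) 1 hu, pd_congr hD hf 0 hu]
  simp only [pd_zero_mul, pd_one_mul]

/-- The Cheng-Yau operator of a product of a function of `s` and a function of `t`. -/
lemma chengYauOp_revolution_mul (hu : u ∈ revolutionDomain I) {f : (Fin 2 → ℝ) → ℝ} {p q : ℝ → ℝ}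
    (hf : Set.EqOn f (fun v => p (v 0) * q (v 1)) (revolutionDomain I)) :
    chengYauOp (revolution x z) f u =
      -(deriv z (u 0) / x (u 0) * (deriv (deriv p) (u 0) * q (u 1))
        + profileCurvature x z (u 0) * ((p (u 0) * deriv (deriv q) (u 1)
          + x (u 0) * deriv x (u 0) * (deriv p (u 0) * q (u 1))) / x (u 0) ^ 2)) := by
  have hD := isOpen_revolutionDomain hC.isOpen
  rw [hC.chengYauOp_revolution hu, pd_congr hD (pd_congr hD hf 0) 0 hu,
    pd_congr hD (pd_congr hD hf 1) 1 hu, pd_congr hD hf 0 hu]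
  simp only [pd_zero_mul, pd_one_mul]

lemma gaussMap_apply_zero : Set.EqOn (fun v => gaussMap (revolution x z) v 0)
    (fun v => (fun s => -deriv z s) (v 0) * Real.cos (v 1)) (revolutionDomain I) := by
  intro v hv
  simp [hC.gaussMap_revolution hv]

lemma gaussMap_apply_one : Set.EqOn (fun v => gaussMap (revolution x z) v 1)
    (fun v => (fun s => -deriv z s) (v 0) * Real.sin (v 1)) (revolutionDomain I) := by
  intro v hv
  simp [hC.gaussMap_revolution hv]

lemma gaussMap_apply_two : Set.EqOn (fun v => gaussMap (revolution x z) v 2)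
    (fun v => deriv x (v 0) * (fun _ => (1 : ℝ)) (v 1)) (revolutionDomain I) := by
  intro v hv
  simp [hC.gaussMap_revolution hv]

/-! ### The two operators on the Gauss map, and reduction to scalar equations. -/

lemma laplaceOp_gaussMap (hu : u ∈ revolutionDomain I) :
    (fun i => laplaceOp (revolution x z) (fun w => gaussMap (revolution x z) w i) u) =
      let k := profileCurvature x z (u 0)
      let k' := deriv (profileCurvature x z) (u 0)
      let c := deriv x (u 0)
      let w := deriv z (u 0)
      let r := x (u 0)
      let p := k' * c - k ^ 2 * w - w / r ^ 2 + c ^ 2 * k / r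
      ![p * Real.cos (u 1), p * Real.sin (u 1), k' * w + k ^ 2 * c + c * k * w / r] := by
  have hx := hC.pos _ hu
  ext i
  fin_cases i
  · simp [hC.laplaceOp_revolution_mul (p := fun s => -deriv z s) (q := Real.cos) hu hC.gaussMap_apply_zero,
      hC.deriv_deriv_z hu,
      hC.deriv_deriv_deriv_z hu]
    field_simp
    ring
  · simp [hC.laplaceOp_revolution_mul (p := fun s => -deriv z s) (q := Real.sin) hu hC.gaussMap_apply_one,
      hC.deriv_deriv_z hu,
      hC.deriv_deriv_deriv_z hu]
    field_simp
    ring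
  · simp [hC.laplaceOp_revolution_mul (p := deriv x) (q := fun _ => 1) hu hC.gaussMap_apply_two,
      hC.deriv_deriv_x hu,
      hC.deriv_deriv_deriv_x hu]
    field_simp
    ring

lemma chengYauOp_gaussMap (hu : u ∈ revolutionDomain I) :
    (fun i => chengYauOp (revolution x z) (fun w => gaussMap (revolution x z) w i) u) =
      let k := profileCurvature x z (u 0)
      let k' := deriv (profileCurvature x z) (u 0)
      let c := deriv x (u 0)
      let w := deriv z (u 0)
      let r := x (u 0)
      let p := (k' * c * w + k ^ 2 * (c ^ 2 - w ^ 2) - k * w / r) / r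
      ![p * Real.cos (u 1), p * Real.sin (u 1), (k' * w ^ 2 + 2 * k ^ 2 * c * w) / r] := by
  have hx := hC.pos _ hu
  ext i
  fin_cases i
  · simp [hC.chengYauOp_revolution_mul (p := fun s => -deriv z s) (q := Real.cos) hu hC.gaussMap_apply_zero,
      hC.deriv_deriv_z hu,
      hC.deriv_deriv_deriv_z hu]
    field_simp
    ring
  · simp [hC.chengYauOp_revolution_mul (p := fun s => -deriv z s) (q := Real.sin) hu hC.gaussMap_apply_one,
      hC.deriv_deriv_z hu,
      hC.deriv_deriv_deriv_z hu]
    field_simp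
    ring
  · simp [hC.chengYauOp_revolution_mul (p := deriv x) (q := fun _ => 1) hu hC.gaussMap_apply_two,
      hC.deriv_deriv_x hu,
      hC.deriv_deriv_deriv_x hu]
    field_simp
    ring

/-- `Δ G = A G` holds with a diagonal matrix `A` if the coordinates satisfy two scalar equations. -/
lemma gaussMapSatisfies_laplaceOp {l m : ℝ}
    (h : ∀ s ∈ I, deriv (profileCurvature x z) s * deriv x s
        - profileCurvature x z s ^ 2 * deriv z s - deriv z s / x s ^ 2
        + deriv x s ^ 2 * profileCurvature x z s / x s = -(l * deriv z s) ∧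
      deriv (profileCurvature x z) s * deriv z s + profileCurvature x z s ^ 2 * deriv x s
        + deriv x s * profileCurvature x z s * deriv z s / x s = m * deriv x s) :
    GaussMapSatisfies (laplaceOp (revolution x z)) (revolution x z) (revolutionDomain I)
      (Matrix.diagonal ![l, l, m]) := by
  intro u hu i
  obtain ⟨h1, h2⟩ := h _ hu
  have h3 := congrFun (hC.laplaceOp_gaussMap hu) i
  simp only [h1, h2] at h3
  rw [h3, hC.gaussMap_revolution hu, Matrix.mulVec_diagonal]
  fin_cases i <;> simp <;> ring

lemma laplaceOp_eq_of_gaussMapSatisfies {A : Matrix (Fin 3) (Fin 3) ℝ}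
    (h : GaussMapSatisfies (laplaceOp (revolution x z)) (revolution x z) (revolutionDomain I) A)
    (hs : s ∈ I) :
    deriv (profileCurvature x z) s * deriv x s
        - profileCurvature x z s ^ 2 * deriv z s - deriv z s / x s ^ 2
        + deriv x s ^ 2 * profileCurvature x z s / x s = -(A 0 0 * deriv z s) := by
  have h0 := h ![s, 0] hs 0
  -- At t = 0 and t = π the sine vanishes and the cosine changes sign, so subtracting the two
  -- equations removes the contribution of A₀₂.
  have h1 := h ![s, Real.pi] hs 0
  have hm (t : ℝ) : ![s, t] ∈ revolutionDomain I := hs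
  rw [congrFun (hC.laplaceOp_gaussMap (hm _)) 0, hC.gaussMap_revolution (hm _)] at h0 h1
  simp [Matrix.mulVec, dotProduct, Fin.sum_univ_three] at h0 h1
  linarith

lemma chengYauOp_eq_of_gaussMapSatisfies {A : Matrix (Fin 3) (Fin 3) ℝ}
    (h : GaussMapSatisfies (chengYauOp (revolution x z)) (revolution x z) (revolutionDomain I) A)
    (hs : s ∈ I) :
    deriv (profileCurvature x z) s * deriv x s * deriv z s
        + profileCurvature x z s ^ 2 * (deriv x s ^ 2 - deriv z s ^ 2)
        - profileCurvature x z s * deriv z s / x s = -(A 0 0 * x s * deriv z s) ∧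
      deriv (profileCurvature x z) s * deriv z s ^ 2
        + 2 * profileCurvature x z s ^ 2 * deriv x s * deriv z s = A 2 2 * x s * deriv x s := by
  have hx := hC.pos s hs
  have hm (t : ℝ) : ![s, t] ∈ revolutionDomain I := hs
  constructor
  · have h0 := h ![s, 0] hs 0
    have h1 := h ![s, Real.pi] hs 0
    rw [congrFun (hC.chengYauOp_gaussMap (hm _)) 0, hC.gaussMap_revolution (hm _)] at h0 h1
    simp [Matrix.mulVec, dotProduct, Fin.sum_univ_three] at h0 h1
    field_simp at h0 h1 ⊢
    linarith
  -- Here the sum of the two equations removes the contribution of A₂₀.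
  · have h0 := h ![s, 0] hs 2
    have h1 := h ![s, Real.pi] hs 2
    rw [congrFun (hC.chengYauOp_gaussMap (hm _)) 2, hC.gaussMap_revolution (hm _)] at h0 h1
    simp [Matrix.mulVec, dotProduct, Fin.sum_univ_three] at h0 h1
    field_simp at h0 h1 ⊢
    linarith

end IsProfileCurve

/-! ### Solving the equations that follow from `□ G = A G`. -/

/-- The three relations satisfied at the points where `x'` and `z'` do not vanish are
incompatible. -/
lemma no_common_zero {k w r m : ℝ} (hw : w ≠ 0) (hr : 0 < r) (hm : m ≠ 0)
    (h1 : m * r ^ 2 * w * (4 * k * r + w) = k * (k * r - w) ^ 2)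
    (h2 : 4 * m * r ^ 2 * w + 9 * k ^ 2 * r + 21 * k * w = 0)
    (h3 : m * r ^ 2 * w * (22 * k * r + 25 * w) = 18 * k ^ 2 * r * (k * r - w)) : False := by
  have hk : k ≠ 0 := by
    rintro rfl
    have : m * r ^ 2 * w = 0 := by linarith
    simp_all [hr.ne']
  have e1 : 8 * (k * r) ^ 2 + 17 * (k * r) * w + 5 * w ^ 2 = 0 := by
    have : 5 * k * (8 * (k * r) ^ 2 + 17 * (k * r) * w + 5 * w ^ 2) = 0 := by
      linear_combination (4 * k * r + w) * h2 - 4 * h1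
    simpa [hk] using this
  have e2 : 18 * (k * r) ^ 2 + 41 * (k * r) * w + 35 * w ^ 2 = 0 := by
    have : 15 * k * (18 * (k * r) ^ 2 + 41 * (k * r) * w + 35 * w ^ 2) = 0 := by
      linear_combination (22 * k * r + 25 * w) * h2 - 4 * h3
    simpa [hk] using this
  -- The quadratic form in `e2` has negative discriminant: 72 times it is (36 k r + 41 w)² + 839 w².
  nlinarith [sq_nonneg (36 * (k * r) + 41 * w), sq_pos_of_ne_zero hw]

namespace IsProfileCurve

variable {x z : ℝ → ℝ} {I : Set ℝ} (hC : IsProfileCurve x z I) {s : ℝ}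

include hC

/-- A function whose derivative vanishes on `I` is constant on `I`. -/
lemma eq_of_hasDerivAt_zero {f : ℝ → ℝ} (hf : ∀ s ∈ I, HasDerivAt f 0 s) {a b : ℝ} (ha : a ∈ I)
    (hb : b ∈ I) : f a = f b :=
  hC.isOpen.is_const_of_deriv_eq_zero hC.ordConnected.isPreconnected
    (fun s hs => (hf s hs).differentiableAt.differentiableWithinAt)
    (fun s hs => (hf s hs).deriv) ha hb

section ChengYau

variable {l m : ℝ}
  (h : ∀ s ∈ I, deriv (profileCurvature x z) s * deriv x s * deriv z s
        + profileCurvature x z s ^ 2 * (deriv x s ^ 2 - deriv z s ^ 2)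
        - profileCurvature x z s * deriv z s / x s = -(l * x s * deriv z s) ∧
      deriv (profileCurvature x z) s * deriv z s ^ 2
        + 2 * profileCurvature x z s ^ 2 * deriv x s * deriv z s = m * x s * deriv x s)

include h

/-- The combination c · (second) - w · (first) of the two equations cancels k'. -/
lemma curvature_relation (hs : s ∈ I) :
    profileCurvature x z s * deriv z s * (profileCurvature x z s * x s + deriv z s) =
      x s ^ 2 * (m - (m - l) * deriv z s ^ 2) := by
  obtain ⟨h1, h2⟩ := h s hs
  have h3 := hC.unit_speed s hs
  have hx := hC.pos s hs
  field_simp at h1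
  linear_combination x s * deriv x s * h2 - deriv z s * h1 +
    (x s ^ 2 * m - profileCurvature x z s ^ 2 * x s * deriv z s) * h3

/-- The complementary combination c · (first) + w · (second), in which c² + w² = 1 isolates k' w. It
expresses the derivative of the Gauss curvature. -/
lemma deriv_curvature_relation (hs : s ∈ I) :
    deriv (profileCurvature x z) s * deriv z s * x s + profileCurvature x z s ^ 2 * deriv x s * x s
      - profileCurvature x z s * deriv z s * deriv x s =
      (m - l) * x s ^ 2 * deriv x s * deriv z s := by
  obtain ⟨h1, h2⟩ := h s hs
  have h3 := hC.unit_speed s hs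
  have hx := hC.pos s hs
  field_simp at h1
  linear_combination deriv x s * h1 + x s * deriv z s * h2 -
    (deriv (profileCurvature x z) s * deriv z s * x s
      + profileCurvature x z s ^ 2 * deriv x s * x s) * h3

lemma hasDerivAt_gaussCurvature (hs : s ∈ I) :
    HasDerivAt (fun r => profileCurvature x z r * deriv z r / x r)
      ((m - l) * deriv x s * deriv z s) s := by
  have hx := hC.pos s hs
  refine (((hC.hasDerivAt_profileCurvature hs).mul (hC.hasDerivAt_deriv_z hs)).div
    (hC.hasDerivAt_x hs) hx.ne').congr_deriv ?_
  have h1 := hC.deriv_curvature_relation h hs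
  simp only [Pi.mul_apply]
  field_simp
  linear_combination h1

omit h in
lemma isOpen_oblique : IsOpen {s | s ∈ I ∧ deriv x s ≠ 0 ∧ deriv z s ≠ 0} := by
  have h1 : ContinuousOn (fun s => (deriv x s, deriv z s)) I :=
    (hC.smooth_x.smooth_deriv hC.isOpen).continuousOn.prodMk
      (hC.smooth_z.smooth_deriv hC.isOpen).continuousOn
  exact h1.isOpen_inter_preimage hC.isOpen
    ((isOpen_ne.prod isOpen_ne : IsOpen ({0}ᶜ ×ˢ {0}ᶜ : Set (ℝ × ℝ))))

/-- Differentiate `curvature_relation` and eliminate k' by `deriv_curvature_relation`; a factor c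
splits off. The next two relations repeat this, multiplying first by w r so that k' occurs only
through k' w r. -/
lemma oblique_relation_one (hs : s ∈ I) (hc : deriv x s ≠ 0) :
    (m - l) * x s ^ 2 * deriv z s * (4 * profileCurvature x z s * x s + deriv z s) =
      profileCurvature x z s * (profileCurvature x z s * x s - deriv z s) ^ 2 := by
  have dk := hC.hasDerivAt_profileCurvature hs
  have dw := hC.hasDerivAt_deriv_z hs
  have dx := hC.hasDerivAt_x hs
  have e := HasDerivAt.eq_of_eqOn hC.isOpen hs
    ((dk.mul dw).mul ((dk.mul dx).add dw))
    ((dx.pow 2).mul (((dw.pow 2).const_mul (m - l)).const_sub m))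
    fun r hr => hC.curvature_relation h hr
  have f := hC.deriv_curvature_relation h hs
  have g := hC.curvature_relation h hs
  apply mul_left_cancel₀ hc
  norm_num at e
  linear_combination x s * e - (2 * profileCurvature x z s * x s + deriv z s) * f
    - 2 * deriv x s * g

lemma oblique_relation_two (hml : m - l ≠ 0) (hs : s ∈ I) (hc : deriv x s ≠ 0)
    (hw : deriv z s ≠ 0) :
    4 * (m - l) * x s ^ 2 * deriv z s + 9 * profileCurvature x z s ^ 2 * x s
      + 21 * profileCurvature x z s * deriv z s = 0 := by
  have dk := hC.hasDerivAt_profileCurvature hs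
  have dw := hC.hasDerivAt_deriv_z hs
  have dx := hC.hasDerivAt_x hs
  have e := HasDerivAt.eq_of_eqOn hC.isOpen_oblique ⟨hs, hc, hw⟩
    ((((dx.pow 2).const_mul (m - l)).mul dw).mul (((dk.const_mul 4).mul dx).add dw))
    (dk.mul (((dk.mul dx).sub dw).pow 2))
    fun r hr => hC.oblique_relation_one h hr.1 hr.2.1
  have f := hC.deriv_curvature_relation h hs
  have g := hC.oblique_relation_one h hs hc
  have hx := (hC.pos s hs).ne'
  apply mul_left_cancel₀ (mul_ne_zero (mul_ne_zero hc hml) (mul_ne_zero (pow_ne_zero 3 hx) hw))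
  norm_num at e
  linear_combination deriv z s * x s * e - (4 * (m - l) * x s ^ 3 * deriv z s
    - (profileCurvature x z s * x s - deriv z s) * (3 * profileCurvature x z s * x s - deriv z s))
      * f + deriv x s * (3 * profileCurvature x z s * x s - deriv z s) * g

lemma oblique_relation_three (hml : m - l ≠ 0) (hs : s ∈ I) (hc : deriv x s ≠ 0)
    (hw : deriv z s ≠ 0) :
    (m - l) * x s ^ 2 * deriv z s * (22 * profileCurvature x z s * x s + 25 * deriv z s) =
      18 * profileCurvature x z s ^ 2 * x s * (profileCurvature x z s * x s - deriv z s) := by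
  have dk := hC.hasDerivAt_profileCurvature hs
  have dw := hC.hasDerivAt_deriv_z hs
  have dx := hC.hasDerivAt_x hs
  have e := HasDerivAt.eq_of_eqOn hC.isOpen_oblique ⟨hs, hc, hw⟩
    (((((dx.pow 2).const_mul (4 * (m - l))).mul dw).add (((dk.pow 2).const_mul 9).mul dx)).add
      ((dk.const_mul 21).mul dw))
    (hasDerivAt_const s (0 : ℝ))
    fun r hr => hC.oblique_relation_two h hml hr.1 hr.2.1 hr.2.2
  have f := hC.deriv_curvature_relation h hs
  have g := hC.oblique_relation_two h hml hs hc hw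
  apply mul_left_cancel₀ hc
  norm_num at e
  linear_combination deriv z s * x s * e
    - (18 * profileCurvature x z s * x s + 21 * deriv z s) * f - deriv x s * deriv z s * g

lemma curvature_eq_zero_of_ne (hml : m - l ≠ 0) (hs : s ∈ I) : profileCurvature x z s = 0 := by
  have hcw : ∀ r ∈ I, deriv x r * deriv z r = 0 := by
    intro r hr
    by_contra hne
    obtain ⟨hc, hw⟩ := mul_ne_zero_iff.1 hne
    exact no_common_zero hw (hC.pos r hr) hml (hC.oblique_relation_one h hr hc)
      (hC.oblique_relation_two h hml hr hc hw) (hC.oblique_relation_three h hml hr hc hw)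
  have e := HasDerivAt.eq_of_eqOn hC.isOpen hs
    ((hC.hasDerivAt_deriv_x hs).mul (hC.hasDerivAt_deriv_z hs)) (hasDerivAt_const s (0 : ℝ)) hcw
  have h1 := hC.unit_speed s hs
  have h0 := hcw s hs
  -- Here `e` says k (c² - w²) = 0, and (c² - w²)² = (c² + w²)² - 4 c² w² = 1.
  linear_combination (deriv x s ^ 2 - deriv z s ^ 2) * e
    - profileCurvature x z s * (deriv x s ^ 2 + deriv z s ^ 2 + 1) * h1
    + 4 * profileCurvature x z s * deriv x s * deriv z s * h0

/-- The profile curve of a surface of revolution with `□ G = A G` is a part of a line, or of a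
circle centred on the axis. -/
lemma curvature_eq_zero_or_isotropic :
    (∀ s ∈ I, profileCurvature x z s = 0) ∨
      ∀ s ∈ I, profileCurvature x z s * x s = deriv z s := by
  by_cases hml : m - l = 0
  swap
  · exact Or.inl fun s hs => hC.curvature_eq_zero_of_ne h hml hs
  obtain ⟨s₀, hs₀⟩ := hC.nonempty
  have hq : ∀ s ∈ I, profileCurvature x z s * deriv z s / x s =
      profileCurvature x z s₀ * deriv z s₀ / x s₀ := fun s hs =>
    hC.eq_of_hasDerivAt_zero (f := fun r => profileCurvature x z r * deriv z r / x r)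
      (fun r hr => by simpa [hml] using hC.hasDerivAt_gaussCurvature h hr) hs hs₀
  generalize profileCurvature x z s₀ * deriv z s₀ / x s₀ = q at hq
  have hq' : ∀ s ∈ I, profileCurvature x z s * deriv z s = q * x s := fun s hs => by
    have := hC.pos s hs
    rw [← hq s hs]
    field_simp
  by_cases hq0 : q = 0
  · left
    intro s hs
    have f := hC.deriv_curvature_relation h hs
    have hx := (hC.pos s hs).ne'
    have h1 := hC.unit_speed s hs
    have h2 := hq' s hs
    rw [hq0, zero_mul] at h2
    by_contra hk
    have hw : deriv z s = 0 := by simpa [hk] using h2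
    simp [hw, hk, hx] at f
    simp [hw, f] at h1
  · right
    -- Now k r and w have product q r² and sum m r / q, so q² (k r - w)² = r² (m² - 4 q³). It
    -- suffices to find k r = w at one point: this fixes the constants, hence gives equality
    -- everywhere.
    have hsum : ∀ s ∈ I, q * (profileCurvature x z s * x s + deriv z s) = x s * m := by
      intro s hs
      have hx := (hC.pos s hs).ne'
      have g := hC.curvature_relation h hs
      apply mul_left_cancel₀ hx
      linear_combination g - (profileCurvature x z s * x s + deriv z s) * hq' s hs
        - x s ^ 2 * deriv z s ^ 2 * hml
    obtain ⟨s₁, hs₁, hc⟩ : ∃ s ∈ I, deriv x s ≠ 0 := by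
      by_contra! hc
      have e := HasDerivAt.eq_of_eqOn hC.isOpen hs₀ (hC.hasDerivAt_deriv_x hs₀)
        (hasDerivAt_const s₀ (0 : ℝ)) hc
      have := hq' s₀ hs₀
      simp_all [(hC.pos s₀ hs₀).ne']
    have hx₁ := (hC.pos s₁ hs₁).ne'
    have hk₁ : profileCurvature x z s₁ ≠ 0 := by
      intro h0
      have := hq' s₁ hs₁
      simp_all
    have hm : m ^ 2 = 4 * q ^ 3 := by
      have h1 := hC.oblique_relation_one h hs₁ hc
      rw [hml] at h1
      have h2 : profileCurvature x z s₁ * x s₁ = deriv z s₁ := by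
        have : (profileCurvature x z s₁ * x s₁ - deriv z s₁) ^ 2 = 0 := by
          apply mul_left_cancel₀ hk₁
          linear_combination -h1
        exact sub_eq_zero.1 (pow_eq_zero_iff two_ne_zero |>.1 this)
      have h3 := hsum s₁ hs₁
      have h4 := hq' s₁ hs₁
      apply mul_left_cancel₀ (pow_ne_zero 2 hx₁)
      rw [← h2] at h3 h4
      linear_combination (-(q * (profileCurvature x z s₁ * x s₁ + profileCurvature x z s₁ * x s₁))
        - x s₁ * m) * h3 + 4 * q ^ 2 * x s₁ * h4
    intro s hs
    have h1 := hsum s hs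
    have h2 := hq' s hs
    have : (q * (profileCurvature x z s * x s - deriv z s)) ^ 2 = 0 := by
      linear_combination (q * (profileCurvature x z s * x s + deriv z s) + x s * m) * h1
        - 4 * q ^ 2 * x s * h2 + x s ^ 2 * hm
    have := pow_eq_zero_iff two_ne_zero |>.1 this
    exact sub_eq_zero.1 ((mul_eq_zero.1 this).resolve_left hq0)

end ChengYau

/-! ### Surfaces with `Δ G = A G`: the umbilic and flat cases. -/

/-- Differentiating k r = w gives k' = 0, so k is constant and the Laplace equations hold with both
eigenvalues 2 k². -/
lemma gaussMapSatisfies_laplaceOp_of_isotropic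
    (hk : ∀ s ∈ I, profileCurvature x z s * x s = deriv z s) :
    ∃ A, GaussMapSatisfies (laplaceOp (revolution x z)) (revolution x z)
      (revolutionDomain I) A := by
  have hk' : ∀ s ∈ I, deriv (profileCurvature x z) s = 0 := by
    intro s hs
    have e := HasDerivAt.eq_of_eqOn hC.isOpen hs
      ((hC.hasDerivAt_profileCurvature hs).mul (hC.hasDerivAt_x hs)) (hC.hasDerivAt_deriv_z hs) hk
    have : deriv (profileCurvature x z) s * x s = 0 := by linarith
    simpa [(hC.pos s hs).ne'] using this
  obtain ⟨s₀, hs₀⟩ := hC.nonempty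
  refine ⟨_, hC.gaussMapSatisfies_laplaceOp (l := 2 * profileCurvature x z s₀ ^ 2)
    (m := 2 * profileCurvature x z s₀ ^ 2) fun s hs => ?_⟩
  rw [← hC.eq_of_hasDerivAt_zero (f := profileCurvature x z)
    (fun r hr => hk' r hr ▸ hC.hasDerivAt_profileCurvature hr) hs hs₀, hk' s hs]
  have hx := (hC.pos s hs).ne'
  have h1 := hC.unit_speed s hs
  have h2 := hk s hs
  rw [← h2] at h1 ⊢
  constructor
  · field_simp
    linear_combination profileCurvature x z s * h1
  · field_simp
    ring

lemma deriv_eq_of_curvature_eq_zero (hk : ∀ s ∈ I, profileCurvature x z s = 0) :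
    ∃ c w : ℝ, c ^ 2 + w ^ 2 = 1 ∧ (∀ s ∈ I, deriv x s = c) ∧ ∀ s ∈ I, deriv z s = w := by
  obtain ⟨s₀, hs₀⟩ := hC.nonempty
  refine ⟨_, _, hC.unit_speed s₀ hs₀, fun s hs => ?_, fun s hs => ?_⟩
  · exact hC.eq_of_hasDerivAt_zero
      (fun r hr => by simpa [hk r hr] using hC.hasDerivAt_deriv_x hr) hs hs₀
  · exact hC.eq_of_hasDerivAt_zero
      (fun r hr => by simpa [hk r hr] using hC.hasDerivAt_deriv_z hr) hs hs₀

lemma deriv_curvature_eq_zero (hk : ∀ s ∈ I, profileCurvature x z s = 0) (hs : s ∈ I) :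
    deriv (profileCurvature x z) s = 0 :=
  HasDerivAt.eq_of_eqOn hC.isOpen hs (hC.hasDerivAt_profileCurvature hs)
    (hasDerivAt_const s (0 : ℝ)) hk

/-- A plane orthogonal to the axis and a circular cylinder satisfy `Δ G = A G`. -/
lemma gaussMapSatisfies_laplaceOp_of_flat (hk : ∀ s ∈ I, profileCurvature x z s = 0)
    (h : (∀ s ∈ I, deriv x s = 0) ∨ ∀ s ∈ I, deriv z s = 0) :
    ∃ A, GaussMapSatisfies (laplaceOp (revolution x z)) (revolution x z)
      (revolutionDomain I) A := by
  obtain ⟨s₀, hs₀⟩ := hC.nonempty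
  -- The value of l is dictated by the cylinder of radius x s₀; for the plane w = 0 and any l would
  -- do.
  refine ⟨_, hC.gaussMapSatisfies_laplaceOp (l := 1 / x s₀ ^ 2) (m := 0) fun s hs => ?_⟩
  rw [hC.deriv_curvature_eq_zero hk hs, hk s hs]
  rcases h with h | h
  · rw [hC.eq_of_hasDerivAt_zero (f := x) (fun r hr => h r hr ▸ hC.hasDerivAt_x hr) hs₀ hs]
    constructor <;> simp
    ring
  · simp [h s hs]

end IsProfileCurve

/-! ### Right circular cones and surfaces of revolution. -/

lemma norm_sub_sq_E3 (p a : E3) :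
    ‖p - a‖ ^ 2 = (p 0 - a 0) ^ 2 + (p 1 - a 1) ^ 2 + (p 2 - a 2) ^ 2 := by
  simp [EuclideanSpace.real_norm_sq_eq, Fin.sum_univ_three]

lemma inner_sub_E3 (v p a : E3) :
    inner ℝ v (p - a) = v 0 * (p 0 - a 0) + v 1 * (p 1 - a 1) + v 2 * (p 2 - a 2) := by
  simp [PiLp.inner_apply, Fin.sum_univ_three, mul_comm]

lemma exists_polar {p q r : ℝ} (hr : 0 < r) (h : p ^ 2 + q ^ 2 = r ^ 2) :
    ∃ t, p = r * Real.cos t ∧ q = r * Real.sin t := by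
  have hn : ‖(⟨p, q⟩ : ℂ)‖ = r := by
    rw [← abs_of_pos hr, ← abs_norm, ← sq_eq_sq_iff_abs_eq_abs, Complex.sq_norm,
      Complex.normSq_mk, ← h]
    ring
  refine ⟨Complex.arg ⟨p, q⟩, ?_, ?_⟩
  · rw [← hn, Complex.norm_mul_cos_arg]
  · rw [← hn, Complex.norm_mul_sin_arg]

/-- If a circle around the third coordinate axis, in a plane orthogonal to it, lies on a right
circular cone, then the axis of the cone is the third coordinate axis. -/
lemma coaxial_of_circle_subset {v a : E3} {k r b : ℝ} (hv : ‖v‖ = 1) (hk : k ≠ 0) (hr : r ≠ 0)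
    (h : ∀ t : ℝ, inner ℝ v (!₂[r * Real.cos t, r * Real.sin t, b] - a) =
      k * ‖!₂[r * Real.cos t, r * Real.sin t, b] - a‖) :
    v 0 = 0 ∧ v 1 = 0 ∧ v 2 ^ 2 = 1 ∧ a 0 = 0 ∧ a 1 = 0 := by
  have e : ∀ C S : ℝ, (∃ t, Real.cos t = C ∧ Real.sin t = S) →
      (v 0 * (r * C - a 0) + v 1 * (r * S - a 1) + v 2 * (b - a 2)) ^ 2 =
        k ^ 2 * ((r * C - a 0) ^ 2 + (r * S - a 1) ^ 2 + (b - a 2) ^ 2) := by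
    rintro _ _ ⟨t, rfl, rfl⟩
    have h1 := congrArg (· ^ 2) (h t)
    simp only [mul_pow, norm_sub_sq_E3, inner_sub_E3] at h1
    simpa using h1
  -- The squared cone equation is a quadratic polynomial in cos t, sin t. Sums over antipodal points
  -- isolate its even part, which gives v₀² = v₁² and v₀ v₁ = 0; differences then isolate the linear
  -- part, which gives a₀ = a₁ = 0.
  have e1 := e 1 0 ⟨0, by simp⟩
  have e2 := e (-1) 0 ⟨Real.pi, by simp⟩
  have e3 := e 0 1 ⟨Real.pi / 2, by simp⟩
  have e4 := e 0 (-1) ⟨-(Real.pi / 2), by simp⟩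
  have e5 := e (√2 / 2) (√2 / 2) ⟨Real.pi / 4, by simp⟩
  have e6 := e (-(√2 / 2)) (-(√2 / 2)) ⟨Real.pi / 4 + Real.pi, by
    simp [Real.cos_add_pi, Real.sin_add_pi]⟩
  have h2 : (√2 / 2) ^ 2 = (1 / 2 : ℝ) := by
    rw [div_pow, Real.sq_sqrt (by norm_num)]
    norm_num
  generalize √2 / 2 = q at e5 e6 h2
  have hvn : v 0 ^ 2 + v 1 ^ 2 + v 2 ^ 2 = 1 := by
    have := norm_sub_sq_E3 v 0
    rw [sub_zero, hv] at this
    simpa using this.symm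
  have f1 : v 0 ^ 2 = v 1 ^ 2 := by
    apply mul_left_cancel₀ (pow_ne_zero 2 hr)
    linear_combination (e1 + e2 - e3 - e4) / 2
  have f2 : v 0 * v 1 = 0 := by
    apply mul_left_cancel₀ (pow_ne_zero 2 hr)
    linear_combination (e5 + e6 - e1 - e2) / 2 + r ^ 2 / 2 * f1
      - r ^ 2 * ((v 0 + v 1) ^ 2 - 2 * k ^ 2) * h2
  have v0 : v 0 = 0 := by
    rcases mul_eq_zero.1 f2 with h | h
    · exact h
    · simpa [h] using f1
  have v1 : v 1 = 0 := by simpa [v0] using f1.symm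
  rw [v0, v1] at e1 e2 e3 e4 hvn
  refine ⟨v0, v1, by linarith, ?_, ?_⟩
  · apply mul_left_cancel₀ (mul_ne_zero (pow_ne_zero 2 hk) hr)
    linear_combination (e1 - e2) / 4
  · apply mul_left_cancel₀ (mul_ne_zero (pow_ne_zero 2 hk) hr)
    linear_combination (e3 - e4) / 4

namespace IsProfileCurve

variable {x z : ℝ → ℝ} {I : Set ℝ} (hC : IsProfileCurve x z I) {s : ℝ}

include hC

/-- If a surface of revolution lies on a right circular cone then its profile curve is a part of a
line which is neither parallel nor orthogonal to the axis. -/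
lemma exists_slope_of_subset_cone {C : Set E3} (hcone : IsRightCircularCone C)
    (hsub : revolution x z '' revolutionDomain I ⊆ C) :
    ∃ β : ℝ, β ≠ 0 ∧ ∀ s ∈ I, deriv z s = β * deriv x s := by
  obtain ⟨a, v, φ, hv, hφ0, hφ1, rfl⟩ := hcone
  have hcos : 0 < Real.cos φ := Real.cos_pos_of_mem_Ioo ⟨by linarith [Real.pi_pos], hφ1⟩
  have hsin : 0 < Real.sin φ := Real.sin_pos_of_pos_of_lt_pi hφ0 (by linarith [Real.pi_pos])
  have hcircle : ∀ s ∈ I, ∀ t : ℝ,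
      inner ℝ v (!₂[x s * Real.cos t, x s * Real.sin t, z s] - a) =
        Real.cos φ * ‖!₂[x s * Real.cos t, x s * Real.sin t, z s] - a‖ := fun s hs t =>
    (hsub (Set.mem_image_of_mem _ (show ![s, t] ∈ revolutionDomain I from hs))).2
  obtain ⟨s₀, hs₀⟩ := hC.nonempty
  obtain ⟨v0, v1, v2, a0, a1⟩ :=
    coaxial_of_circle_subset hv hcos.ne' (hC.pos s₀ hs₀).ne' (hcircle s₀ hs₀)
  have v2' : v 2 ≠ 0 := by
    rintro h
    simp [h] at v2
  have hline : ∀ s ∈ I, Real.sin φ * z s = Real.sin φ * a 2 + v 2 * Real.cos φ * x s := by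
    intro s hs
    have h1 := hcircle s hs 0
    have h2 := norm_sub_sq_E3 !₂[x s * Real.cos 0, x s * Real.sin 0, z s] a
    have h3 := norm_nonneg (!₂[x s * Real.cos 0, x s * Real.sin 0, z s] - a)
    rw [inner_sub_E3] at h1
    generalize ‖!₂[x s * Real.cos 0, x s * Real.sin 0, z s] - a‖ = n at h1 h2 h3
    simp [v0, v1, a0, a1] at h1 h2
    have h4 : Real.sin φ * (v 2 * (z s - a 2)) = Real.cos φ * x s := by
      have hx := hC.pos s hs
      -- By `h1` the height v₂ (z - a₂) equals cos φ · n ≥ 0: the cone has a single nappe, so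
      -- squares may be compared.
      rw [← sq_eq_sq₀ (by rw [h1]; positivity) (by positivity)]
      linear_combination (v 2 * (z s - a 2) + Real.cos φ * n) * h1 + Real.cos φ ^ 2 * h2
        + v 2 ^ 2 * (z s - a 2) ^ 2 * Real.sin_sq_add_cos_sq φ
        - Real.cos φ ^ 2 * (z s - a 2) ^ 2 * v2
    linear_combination v 2 * h4 - Real.sin φ * (z s - a 2) * v2
  refine ⟨v 2 * Real.cos φ / Real.sin φ,
    div_ne_zero (mul_ne_zero v2' hcos.ne') hsin.ne', fun s hs => ?_⟩
  have e := HasDerivAt.eq_of_eqOn hC.isOpen hs ((hC.hasDerivAt_z hs).const_mul (Real.sin φ))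
    (((hC.hasDerivAt_x hs).const_mul (v 2 * Real.cos φ)).const_add (Real.sin φ * a 2)) hline
  field_simp
  linarith

lemma curvature_eq_zero_of_slope {β : ℝ} (h : ∀ s ∈ I, deriv z s = β * deriv x s) (hs : s ∈ I) :
    profileCurvature x z s = 0 := by
  have e := HasDerivAt.eq_of_eqOn hC.isOpen hs (hC.hasDerivAt_deriv_z hs)
    ((hC.hasDerivAt_deriv_x hs).const_mul β) h
  have h1 := hC.unit_speed s hs
  have h2 := h s hs
  linear_combination deriv x s * e + profileCurvature x z s * deriv z s * h2
    - profileCurvature x z s * h1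

lemma gaussMapSatisfies_chengYauOp_of_curvature_eq_zero
    (hk : ∀ s ∈ I, profileCurvature x z s = 0) :
    GaussMapSatisfies (chengYauOp (revolution x z)) (revolution x z) (revolutionDomain I) 0 := by
  intro u hu i
  rw [congrFun (hC.chengYauOp_gaussMap hu) i, hk _ hu, hC.deriv_curvature_eq_zero hk hu]
  fin_cases i <;> simp

lemma not_gaussMapSatisfies_laplaceOp_of_slope {β : ℝ} (hβ : β ≠ 0)
    (h : ∀ s ∈ I, deriv z s = β * deriv x s) (A : Matrix (Fin 3) (Fin 3) ℝ) :
    ¬ GaussMapSatisfies (laplaceOp (revolution x z)) (revolution x z) (revolutionDomain I) A := by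
  intro hA
  have hc : ∀ s ∈ I, deriv x s ≠ 0 := by
    intro s hs h0
    have h1 := hC.unit_speed s hs
    simp [h s hs, h0] at h1
  have hk := fun s (hs : s ∈ I) => hC.curvature_eq_zero_of_slope h hs
  have hx : ∀ s ∈ I, A 0 0 * x s ^ 2 = 1 := by
    intro s hs
    have e := hC.laplaceOp_eq_of_gaussMapSatisfies hA hs
    have hw : deriv z s ≠ 0 := by
      rw [h s hs]
      exact mul_ne_zero hβ (hc s hs)
    have := hC.pos s hs
    rw [hk s hs, hC.deriv_curvature_eq_zero hk hs] at e
    field_simp at e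
    apply mul_left_cancel₀ hw
    linarith
  obtain ⟨s, hs⟩ := hC.nonempty
  have e := HasDerivAt.eq_of_eqOn hC.isOpen hs (((hC.hasDerivAt_x hs).pow 2).const_mul (A 0 0))
    (hasDerivAt_const s (1 : ℝ)) hx
  have hA0 : A 0 0 ≠ 0 := by
    intro h0
    have := hx s hs
    simp [h0] at this
  simp [hA0, hc s hs, (hC.pos s hs).ne'] at e

/-- Rotation of a line segment that is neither parallel nor orthogonal to the axis gives an open
part of a right circular cone. -/
lemma isOpenPart_cone_of_line {c w : ℝ} (hcw : c ^ 2 + w ^ 2 = 1) (hc : c ≠ 0) (hw : w ≠ 0)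
    (hx : ∀ s ∈ I, deriv x s = c) (hz : ∀ s ∈ I, deriv z s = w) :
    ∃ C : Set E3, IsRightCircularCone C ∧
      IsOpenPart (revolution x z '' revolutionDomain I) C := by
  obtain ⟨s₀, hs₀⟩ := hC.nonempty
  obtain ⟨ξ, hξ⟩ : ∃ ξ, ∀ s ∈ I, x s = c * s + ξ := by
    refine ⟨x s₀ - c * s₀, fun s hs => ?_⟩
    have := hC.eq_of_hasDerivAt_zero (f := fun r => x r - c * r) (fun r hr =>
      ((hC.hasDerivAt_x hr).sub ((hasDerivAt_id r).const_mul c)).congr_deriv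
        (by simp [hx r hr])) hs hs₀
    linarith
  obtain ⟨ζ, hζ⟩ : ∃ ζ, ∀ s ∈ I, z s = w * s + ζ := by
    refine ⟨z s₀ - w * s₀, fun s hs => ?_⟩
    have := hC.eq_of_hasDerivAt_zero (f := fun r => z r - w * r) (fun r hr =>
      ((hC.hasDerivAt_z hr).sub ((hasDerivAt_id r).const_mul w)).congr_deriv
        (by simp [hz r hr])) hs hs₀
    linarith
  -- The sign σ directs the cone's axis towards the nappe containing the surface; the apex `a` below
  -- is where the profile line meets the axis of revolution.
  obtain ⟨σ, hσ, hσw⟩ : ∃ σ : ℝ, |σ| = 1 ∧ σ * (w / c) = |w| / |c| := by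
    rcases abs_choice (w / c) with h | h
    · exact ⟨1, by simp, by rw [← abs_div, h, one_mul]⟩
    · exact ⟨-1, by simp, by rw [← abs_div, h]; ring⟩
  have hc' : 0 < |c| := abs_pos.2 hc
  have hw' : 0 < |w| := abs_pos.2 hw
  have hcw' : |c| ^ 2 + |w| ^ 2 = 1 := by simpa using hcw
  have hw1 : |w| < 1 := by nlinarith
  set a : E3 := !₂[0, 0, ζ - w * ξ / c] with ha
  set v : E3 := !₂[0, 0, σ] with hv
  have hz' : ∀ s ∈ I, z s - a 2 = w / c * x s := by
    intro s hs
    simp only [ha, hξ s hs, hζ s hs]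
    simp
    field_simp
    ring
  have hinner : ∀ p : E3, inner ℝ v (p - a) = σ * (p 2 - a 2) := by
    intro p
    simp [inner_sub_E3, hv]
  refine ⟨{p | p ≠ a ∧ inner ℝ v (p - a) = Real.cos (Real.arccos |w|) * ‖p - a‖},
    ⟨a, v, Real.arccos |w|, ?_, Real.arccos_pos.2 hw1, Real.arccos_lt_pi_div_two.2 hw', rfl⟩,
    -- As w ≠ 0, the height determines the parameter s, so the surface is cut out of the cone by a
    -- condition on the height alone.
    {p | (p 2 - ζ) / w ∈ I}, hC.isOpen.preimage (by fun_prop), ?_⟩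
  · simp [hv, EuclideanSpace.norm_eq, Fin.sum_univ_three, Real.sqrt_sq_eq_abs, hσ]
  rw [Real.cos_arccos (by linarith) hw1.le]
  have key : ∀ s ∈ I, ∀ p : E3, p 2 = z s →
      ((p ≠ a ∧ inner ℝ v (p - a) = |w| * ‖p - a‖) ↔ p 0 ^ 2 + p 1 ^ 2 = x s ^ 2) := by
    intro s hs p hp
    have hxs := hC.pos s hs
    have hn := norm_sub_sq_E3 p a
    rw [hp, hz' s hs] at hn
    simp only [ha] at hn
    simp only [Matrix.cons_val_zero, Matrix.cons_val_one, sub_zero] at hn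
    rw [← ha] at hn
    rw [hinner, hp, hz' s hs, ← mul_assoc, hσw]
    have hiff : |w| / |c| * x s = |w| * ‖p - a‖ ↔ ‖p - a‖ = x s / |c| := by
      constructor
      · intro h
        field_simp at h ⊢
        linarith
      · intro h
        rw [h]
        ring
    rw [hiff, ← sq_eq_sq₀ (norm_nonneg _) (by positivity), hn, div_pow, sq_abs]
    constructor
    · rintro ⟨-, h⟩
      field_simp at h
      apply mul_left_cancel₀ (pow_ne_zero 2 hc)
      linear_combination h - x s ^ 2 * hcw
    · intro h
      refine ⟨?_, ?_⟩
      · rintro rfl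
        simp [ha] at h
        exact pow_ne_zero 2 hxs.ne' h.symm
      · rw [h]
        field_simp
        exact hcw
  ext p
  constructor
  · rintro ⟨u, hu, rfl⟩
    refine ⟨?_, (key (u 0) hu _ (by simp [revolution])).2 ?_⟩
    · have hu' : u 0 ∈ I := hu
      simpa [revolution, hζ _ hu', hw] using hu'
    · simp only [revolution, PiLp.toLp_apply, Matrix.cons_val_zero, Matrix.cons_val_one]
      linear_combination x (u 0) ^ 2 * Real.sin_sq_add_cos_sq (u 1)
  · rintro ⟨hs, hp⟩
    have hpz : p 2 = z ((p 2 - ζ) / w) := by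
      rw [hζ _ hs]
      field_simp
      ring
    obtain ⟨t, h0, h1⟩ := exists_polar (hC.pos _ hs) ((key _ hs p hpz).1 hp)
    refine ⟨![(p 2 - ζ) / w, t], hs, ?_⟩
    ext i
    fin_cases i
    · exact h0.symm
    · exact h1.symm
    · exact hpz.symm

end IsProfileCurve
theorem corollary4p3 (x z : ℝ → ℝ) (I : Set ℝ) (hC : IsProfileCurve x z I) :
    (∃ C : Set E3, IsRightCircularCone C ∧
        IsOpenPart (revolution x z '' revolutionDomain I) C) ↔
      ((∃ A : Matrix (Fin 3) (Fin 3) ℝ,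
          GaussMapSatisfies (chengYauOp (revolution x z)) (revolution x z)
            (revolutionDomain I) A) ∧
        ¬ ∃ A : Matrix (Fin 3) (Fin 3) ℝ,
          GaussMapSatisfies (laplaceOp (revolution x z)) (revolution x z)
            (revolutionDomain I) A) := by
  constructor
  · rintro ⟨C, hcone, U, -, hM⟩
    obtain ⟨β, hβ, h⟩ := hC.exists_slope_of_subset_cone hcone (hM ▸ Set.inter_subset_right)
    exact ⟨⟨0, hC.gaussMapSatisfies_chengYauOp_of_curvature_eq_zero
        fun s hs => hC.curvature_eq_zero_of_slope h hs⟩,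
      fun ⟨A, hA⟩ => hC.not_gaussMapSatisfies_laplaceOp_of_slope hβ h A hA⟩
  · rintro ⟨⟨A, hA⟩, hΔ⟩
    rcases hC.curvature_eq_zero_or_isotropic
      (fun s hs => hC.chengYauOp_eq_of_gaussMapSatisfies hA hs) with hk | hk
    · obtain ⟨c, w, hcw, hx, hz⟩ := hC.deriv_eq_of_curvature_eq_zero hk
      refine hC.isOpenPart_cone_of_line hcw ?_ ?_ hx hz
      · rintro rfl
        exact hΔ (hC.gaussMapSatisfies_laplaceOp_of_flat hk (Or.inl hx))
      · rintro rfl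
        exact hΔ (hC.gaussMapSatisfies_laplaceOp_of_flat hk (Or.inr hz))
    · exact absurd (hC.gaussMapSatisfies_laplaceOp_of_isotropic hk) hΔ
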